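/- Let $a>0$, $\Omega=(0,a)$ and $\lambda_1\in\mathbb{R}$. Let $F:(-a,a)\to\mathbb{C}$ be continuous and positive definite, that is, $\sum_{i}\sum_{j}\overline{c_i}\,c_j\,F(x_i-x_j)\ge 0$ for all finite systems of points $x_i\in\Omega$ and scalars $c_i\in\mathbb{C}$. Let $Ext(F)$ be the set of finite positive Borel measures $\mu$ on $\mathbb{R}$ with $\int_{\mathbb{R}}e^{i\lambda x}\,d\mu(\lambda)=F(x)$ for all $x\in(-a,a)$. Let $\mathscr{H}_F$ be the reproducing kernel Hilbert space of the kernel $(x,y)\mapsto F(x-y)$ on $\Omega\times\Omega$, i.e. the Hilbert space of functions on $\Omega$ obtained by completing the span of the functions $F_y=F(\cdot-y)$, $y\in\Omega$, with respect to the inner product determined by $\langle F_x,F_y\rangle_{\mathscr{H}_F}=F(x-y)$. Then the following two conditions are equivalent: (1) there is a measure $\mu_1\in Ext(F)$ with $\mu_1(\{\lambda_1\})>0$ (that is, $\mu_1$ has an atom at $\lambda_1$); (2) the function $e_{\lambda_1}(x)=e^{i\lambda_1x}$, $x\in\Omega$, belongs to $\mathscr{H}_F$. -/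

import Mathlib

open MeasureTheory Set
open scoped ComplexOrder ComplexConjugate

/-- A function `F`, of which only the values on `(-a, a) = Ω - Ω` with `Ω = (0, a)` matter, is
positive definite if `∑ᵢ ∑ⱼ conj cᵢ * cⱼ * F (xᵢ - xⱼ)` is a nonnegative real number for all finite
systems of points `xᵢ ∈ Ω` and of scalars `cᵢ ∈ ℂ`. -/
def IsLocallyPD (a : ℝ) (F : ℝ → ℂ) : Prop :=
  ∀ (n : ℕ) (x : Fin n → ℝ) (c : Fin n → ℂ), (∀ i, x i ∈ Ioo 0 a) →
    0 ≤ ∑ i, ∑ j, conj (c i) * c j * F (x i - x j)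

/-- The set `Ext(F)` of the finite positive Borel measures on `ℝ` whose Fourier transform
`x ↦ ∫ e^{iλx} dμ(λ)` extends `F` from `(-a, a)` to `ℝ`. -/
def ExtMeasures (a : ℝ) (F : ℝ → ℂ) : Set (Measure ℝ) :=
  {μ | IsFiniteMeasure μ ∧
    ∀ x ∈ Ioo (-a) a, F x = ∫ l : ℝ, Complex.exp (Complex.I * (l : ℂ) * (x : ℂ)) ∂μ}

/-- The kernel `(x, y) ↦ F (x - y)` on `Ω × Ω`, `Ω = (0, a)`. Mathlib's kernels are operator-valued,
so a complex number is read as the operator of multiplication by it. -/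
noncomputable def localKernel (a : ℝ) (F : ℝ → ℂ) :
    Matrix (Ioo (0 : ℝ) a) (Ioo (0 : ℝ) a) (ℂ →L[ℂ] ℂ) :=
  Matrix.of fun x y => F ((x : ℝ) - (y : ℝ)) • (1 : ℂ →L[ℂ] ℂ)

theorem IsLocallyPD.conj_sub {a : ℝ} {F : ℝ → ℂ} (hF : IsLocallyPD a F) {x y : ℝ}
    (hx : x ∈ Ioo 0 a) (hy : y ∈ Ioo 0 a) : conj (F (y - x)) = F (x - y) := by
  have h0 := hF 1 ![x] ![1] (by simpa using hx)
  have h1 := hF 2 ![x, y] ![1, 1] (by intro i; fin_cases i <;> simpa)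
  have h2 := hF 2 ![x, y] ![1, Complex.I] (by intro i; fin_cases i <;> simpa)
  simp [Fin.sum_univ_two, Complex.le_def] at h0 h1 h2
  apply Complex.ext <;> simp <;> linarith [h0.2, h1.2, h2.2]

theorem IsLocallyPD.posSemidef {a : ℝ} {F : ℝ → ℂ} (hF : IsLocallyPD a F) :
    (localKernel a F).PosSemidef := by
  have hiff := (RKHS.posSemidef_tfae (K := localKernel a F)).out 0 2
  refine hiff.mpr ⟨?_, fun v => ?_⟩
  · ext1 x y
    simp only [localKernel, Matrix.conjTranspose_apply, Matrix.of_apply, star_smul, star_one]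
    rw [← hF.conj_sub x.2 y.2]
    rfl
  · let e := v.support.equivFin
    have h := hF v.support.card (fun i => ((e.symm i : Ioo (0 : ℝ) a) : ℝ))
      (fun i => v (e.symm i)) (fun i => (e.symm i).1.2)
    have h' := (Complex.le_def.mp h).1
    rw [e.symm.sum_comp (fun i : v.support => ∑ j, conj (v i) * v (e.symm j) *
      F (((i : Ioo (0 : ℝ) a) : ℝ) - ((e.symm j : Ioo (0 : ℝ) a) : ℝ)))] at h'
    simp_rw [fun i : v.support => e.symm.sum_comp (fun j : v.support => conj (v i) * v j *
      F (((i : Ioo (0 : ℝ) a) : ℝ) - ((j : Ioo (0 : ℝ) a) : ℝ)))] at h'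
    rw [v.support.sum_coe_sort (fun i => ∑ j : v.support, conj (v i) * v j *
      F ((i : ℝ) - ((j : Ioo (0 : ℝ) a) : ℝ)))] at h'
    simp_rw [fun i : Ioo (0 : ℝ) a => v.support.sum_coe_sort (fun j => conj (v i) * v j *
      F ((i : ℝ) - (j : ℝ)))] at h'
    refine h'.trans_eq ?_
    simp only [Finsupp.sum, localKernel, Matrix.of_apply]
    refine congrArg Complex.re (Finset.sum_congr rfl fun i _ => Finset.sum_congr rfl fun j _ => ?_)
    simp [← hF.conj_sub i.2 j.2]
    ring

/-- The reproducing kernel Hilbert space `ℋ_F` of the kernel `F (x - y)` on `Ω = (0, a)`, i.e. the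
Hilbert completion of the span of the functions `F (· - y)`, `y ∈ Ω`, as a space of functions
on `Ω`. -/
noncomputable def localRKHS {a : ℝ} {F : ℝ → ℂ} (hF : IsLocallyPD a F) :
    Submodule ℂ (Ioo (0 : ℝ) a → ℂ) :=
  haveI : Fact (localKernel a F).PosSemidef := ⟨hF.posSemidef⟩
  LinearMap.range (RKHS.coeCLM ℂ (H := RKHS.OfKernel (localKernel a F))).toLinearMap

/-! Both conditions say that some `c > 0` makes `F(x - y) - c e_{λ₁}(x) conj(e_{λ₁}(y))` a positive
definite kernel on `Ω`. For `ℋ_F` this is the Cauchy–Schwarz and Riesz criterion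
(`exists_dominated_of_mem_localRKHS`, `mem_localRKHS_of_dominated`). An atom gives it because the
quadratic form of `F` is `∫ |g|² dμ` for a trigonometric polynomial `g`, hence at least `μ{λ₁}
|g(λ₁)|²`. Conversely `G = F - c e_{λ₁}` is again continuous and positive definite on `(-a, a)`, so
it has an extending measure `ν`, and `ν + c δ_{λ₁}` extends `F`.

The weight of the proof is the existence of `ν` (`IsLocallyPD.extMeasures_nonempty`). On a grid the
values of the function form a finite Toeplitz sequence, solved by Carathéodory's theorem through the
spectral decomposition of a shift isometry. Continuity at `0` makes the measures for dyadic grids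
tight (`measureReal_tail_le`), and continuity carries the identity for a weak limit from dyadic
points to the interval. -/

/-! ### Finite-dimensional isometries and Carathéodory's moment theorem -/

section Caratheodory

variable {E : Type*} [NormedAddCommGroup E] [InnerProductSpace ℂ E]

theorem LinearIsometry.norm_eigenvalue (U : E →ₗᵢ[ℂ] E) {z : ℂ} {v : E} (hv : v ≠ 0)
    (h : U v = z • v) : ‖z‖ = 1 := by
  have := U.norm_map v
  rw [h, norm_smul] at this
  exact (mul_eq_right₀ (norm_ne_zero_iff.2 hv)).1 this

theorem LinearIsometry.inner_eigenvector_eq_zero (U : E →ₗᵢ[ℂ] E) {z : ℂ} {v w : E}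
    (h : U v = z • v) (hvw : inner ℂ v w = 0) : inner ℂ v (U w) = 0 := by
  by_cases hv : v = 0
  · simp [hv]
  have h1 := U.inner_map_map v w
  rw [h, hvw, inner_smul_left] at h1
  refine (mul_eq_zero.1 h1).resolve_left fun hz => ?_
  have := U.norm_eigenvalue hv h
  simp_all

theorem LinearIsometry.inner_eigenvectors_eq_zero (U : E →ₗᵢ[ℂ] E) {z t : ℂ} {v w : E}
    (hv : U v = z • v) (hw : U w = t • w) (hzt : z ≠ t) : inner ℂ v w = 0 := by
  by_cases hv0 : v = 0
  · simp [hv0]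
  have h1 := U.inner_map_map v w
  have hz : conj z * z = 1 := by
    rw [mul_comm, Complex.mul_conj, Complex.normSq_eq_norm_sq, U.norm_eigenvalue hv0 hv]; simp
  rw [hv, hw, inner_smul_left, inner_smul_right] at h1
  have h2 : conj z * (t - z) * inner ℂ v w = 0 := by linear_combination h1 - hz * inner ℂ v w
  have hz0 : conj z ≠ 0 := left_ne_zero_of_mul_eq_one hz
  simpa [hz0, sub_eq_zero, hzt.symm] using h2

/-- The vectors orthogonal to all eigenvectors form an invariant subspace; if it were nonzero, it
would contain an eigenvector, which would be orthogonal to itself. -/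
theorem LinearIsometry.iSup_eigenspace_eq_top [FiniteDimensional ℂ E] (U : E →ₗᵢ[ℂ] E) :
    ⨆ z : ℂ, Module.End.eigenspace U.toLinearMap z = ⊤ := by
  rw [← Submodule.orthogonal_eq_bot_iff]
  set W := (⨆ z : ℂ, Module.End.eigenspace U.toLinearMap z)ᗮ with hW
  have hmem : ∀ w, w ∈ W ↔ ∀ (z : ℂ) (v : E), U v = z • v → inner ℂ v w = 0 := by
    intro w
    rw [hW, ← Submodule.iInf_orthogonal, Submodule.mem_iInf]
    simp only [Submodule.mem_orthogonal, Module.End.mem_eigenspace_iff,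
      LinearIsometry.coe_toLinearMap]
  have hinv : ∀ w ∈ W, U.toLinearMap w ∈ W := fun w hw => (hmem _).2 fun z v h =>
    U.inner_eigenvector_eq_zero (z := z) h ((hmem w).1 hw z v h)
  by_contra hne
  have : Nontrivial W := Submodule.nontrivial_iff_ne_bot.2 hne
  obtain ⟨z, hz⟩ := Module.End.exists_eigenvalue (U.toLinearMap.restrict hinv)
  obtain ⟨w, hw⟩ := hz.exists_hasEigenvector
  have h1 : U (w : E) = z • (w : E) := congrArg Subtype.val hw.apply_eq_smul
  exact hw.2 (Subtype.ext (inner_self_eq_zero.1 ((hmem w).1 w.2 z w h1)))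

/-- The moments of a linear isometry of a finite dimensional space at a vector are those of an
atomic measure on the unit circle. -/
theorem LinearIsometry.exists_moments [FiniteDimensional ℂ E] (U : E →ₗᵢ[ℂ] E) (e : E) :
    ∃ (s : Finset ℂ) (m : ℂ → NNReal), (∀ z ∈ s, ‖z‖ = 1) ∧
      ∀ k : ℕ, inner ℂ e ((U : E → E)^[k] e) = ∑ z ∈ s, (m z : ℂ) * z ^ k := by
  have he : e ∈ ⨆ z : ℂ, Module.End.eigenspace U.toLinearMap z := by
    rw [U.iSup_eigenspace_eq_top]; trivial
  obtain ⟨f, hf, hsum⟩ := (Submodule.mem_iSup_iff_exists_finsupp _ _).1 he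
  have hf' : ∀ z, U (f z) = z • f z := fun z => Module.End.mem_eigenspace_iff.1 (hf z)
  refine ⟨f.support, fun z => ‖f z‖₊ ^ 2, fun z hz =>
    U.norm_eigenvalue (Finsupp.mem_support_iff.1 hz) (hf' z), fun k => ?_⟩
  have hpow : (U : E → E)^[k] e = ∑ z ∈ f.support, z ^ k • f z := by
    induction k with
    | zero => simp [← hsum, Finsupp.sum]
    | succ k ih =>
      rw [Function.iterate_succ_apply', ih, map_sum]
      refine Finset.sum_congr rfl fun z _ => ?_
      rw [map_smul, hf', smul_smul, pow_succ]
  rw [hpow]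
  conv_lhs => rw [← hsum, Finsupp.sum, sum_inner]
  refine Finset.sum_congr rfl fun z hz => ?_
  rw [inner_sum, Finset.sum_eq_single_of_mem z hz]
  · rw [inner_smul_right, inner_self_eq_norm_sq_to_K]
    push_cast
    simp [mul_comm]
  · intro t _ ht
    rw [inner_smul_right, U.inner_eigenvectors_eq_zero (hf' z) (hf' t) ht.symm, mul_zero]

/-- Two finite families of vectors with the same Gram matrix are related by an isometry. -/
theorem exists_linearIsometry_of_inner_eq [FiniteDimensional ℂ E] {ι : Type*} [Fintype ι]
    (v w : ι → E) (h : ∀ i j, inner ℂ (v i) (v j) = inner ℂ (w i) (w j)) :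
    ∃ U : E →ₗᵢ[ℂ] E, ∀ i, U (v i) = w i := by
  classical
  let A := Fintype.linearCombination ℂ v
  let B := Fintype.linearCombination ℂ w
  -- Equal Gram matrices give equal norms, so `A c ↦ B c` is well defined and isometric on the span
  -- of `v`; `extend` then makes it an endomorphism of `E`.
  have hn : ∀ c, ‖B c‖ = ‖A c‖ := by
    intro c
    have : inner ℂ (A c) (A c) = inner ℂ (B c) (B c) := by
      simp only [A, B, Fintype.linearCombination_apply, sum_inner, inner_sum, inner_smul_left,
        inner_smul_right, h]
    rw [inner_self_eq_norm_sq_to_K, inner_self_eq_norm_sq_to_K] at this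
    norm_cast at this
    exact (pow_left_inj₀ (norm_nonneg _) (norm_nonneg _) two_ne_zero).1 this.symm
  have hker : LinearMap.ker A ≤ LinearMap.ker B := fun c hc => by
    rw [LinearMap.mem_ker] at hc ⊢
    rw [← norm_eq_zero, hn, hc, norm_zero]
  let T : LinearMap.range A →ₗ[ℂ] E :=
    ((LinearMap.ker A).liftQ B hker).comp A.quotKerEquivRange.symm.toLinearMap
  have hT : ∀ c, T ⟨A c, LinearMap.mem_range_self A c⟩ = B c := by
    intro c
    have : A.quotKerEquivRange.symm ⟨A c, LinearMap.mem_range_self A c⟩ =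
        (LinearMap.ker A).mkQ c := by
      rw [LinearEquiv.symm_apply_eq]; rfl
    simp [T, this]
  let L : LinearMap.range A →ₗᵢ[ℂ] E :=
    ⟨T, by rintro ⟨_, c, rfl⟩; rw [hT, hn]; rfl⟩
  refine ⟨L.extend, fun i => ?_⟩
  have hA : A (Pi.single i 1) = v i := by simp [A]
  have hB : B (Pi.single i 1) = w i := by simp [B]
  rw [← hA, ← hB, ← hT]
  exact L.extend_apply ⟨A (Pi.single i 1), _⟩

theorem Matrix.PosSemidef.exists_inner_eq {ι : Type*} [Finite ι] {T : Matrix ι ι ℂ}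
    (hT : T.PosSemidef) :
    ∃ (m : ℕ) (v : ι → EuclideanSpace ℂ (Fin m)), ∀ i j, inner ℂ (v i) (v j) = T i j := by
  obtain ⟨m, v, rfl⟩ := Matrix.posSemidef_iff_eq_sum_vecMulVec.1 hT
  refine ⟨m, fun i => WithLp.toLp 2 fun k => conj (v k i), fun i j => ?_⟩
  simp [PiLp.inner_apply, Matrix.sum_apply, Matrix.vecMulVec_apply, mul_comm]

/-- Carathéodory's theorem: a finite positive semidefinite Toeplitz sequence is the sequence of
moments of a finite measure on the circle. -/
theorem exists_measure_of_posSemidef_toeplitz (N : ℕ) (c : ℤ → ℂ)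
    (hc : (Matrix.of fun i j : Fin (N + 1) => c ((i : ℤ) - (j : ℤ))).PosSemidef) :
    ∃ μ : Measure ℝ, IsFiniteMeasure μ ∧ μ {θ | Real.pi < |θ|} = 0 ∧
      ∀ k : ℕ, k ≤ N → c k = ∫ θ : ℝ, Complex.exp (Complex.I * θ * k) ∂μ := by
  obtain ⟨d, v, hv⟩ := hc.exists_inner_eq
  -- The Toeplitz property says that the shift `v i ↦ v (i + 1)` preserves inner products.
  obtain ⟨U, hU⟩ := exists_linearIsometry_of_inner_eq (fun i : Fin N => v i.castSucc)
    (fun i : Fin N => v i.succ) (by intro i j; simp [hv])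
  have hiter : ∀ (k : ℕ) (hk : k < N + 1), (U : _ → _)^[k] (v 0) = v ⟨k, hk⟩ := by
    intro k
    induction k with
    | zero => intro _; rfl
    | succ k ih =>
      intro hk
      rw [Function.iterate_succ_apply', ih (by omega)]
      exact hU ⟨k, by omega⟩
  obtain ⟨s, m, hs, hm⟩ := U.exists_moments (v 0)
  -- The angles are negated since `⟪v 0, v k⟫` is `c (-k)`, the conjugate of `c k`.
  refine ⟨∑ z ∈ s, m z • Measure.dirac (-z.arg), inferInstance, ?_, fun k hk => ?_⟩
  · rw [Measure.finsetSum_apply]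
    refine Finset.sum_eq_zero fun z _ => ?_
    have hms : MeasurableSet {θ : ℝ | Real.pi < |θ|} :=
      measurableSet_lt measurable_const measurable_norm
    simp [Measure.dirac_apply' _ hms, not_lt.2 (Complex.abs_arg_le_pi z)]
  · have h1 : c k = conj (inner ℂ (v 0) (v ⟨k, by omega⟩)) := by
      rw [inner_conj_symm, hv]; simp
    rw [h1, ← hiter k (by omega), hm, map_sum, integral_finsetSum_measure]
    · refine Finset.sum_congr rfl fun z hz => ?_
      rw [integral_smul_nnreal_measure, integral_dirac]
      have hz' : z = Complex.exp (z.arg * Complex.I) := by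
        conv_lhs => rw [← Complex.norm_mul_exp_arg_mul_I z, hs z hz]
        simp
      have : conj z = Complex.exp (-(z.arg * Complex.I)) := by
        conv_lhs => rw [hz', ← Complex.exp_conj]
        simp
      rw [map_mul, map_pow, this, ← Complex.exp_nat_mul]
      simp only [Complex.conj_ofReal, NNReal.smul_def, Complex.real_smul]
      congr 2
      push_cast
      ring
    · intro z _
      exact (integrable_dirac (by simp)).smul_measure_nnreal

end Caratheodory

/-! ### Tail estimate and measures matching a grid -/

section Krein

open Filter Topology

/-- The sum is `(z ^ M - 1) / (z - 1)`: the numerator is at most `2`, and `|sin t| ≥ 2|t|/π` bounds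
the denominator below by `4 / M`. -/
theorem norm_geom_sum_exp_le {M : ℕ} {θ : ℝ} (hM : 0 < M) (h1 : 2 * Real.pi / M ≤ |θ|)
    (h2 : |θ| ≤ Real.pi) : ‖∑ j ∈ Finset.range M, Complex.exp (Complex.I * θ) ^ j‖ ≤ M / 2 := by
  have hM' : (0 : ℝ) < M := by exact_mod_cast hM
  set z := Complex.exp (Complex.I * θ) with hz
  have hz1 : ‖z‖ = 1 := by rw [hz, mul_comm]; exact Complex.norm_exp_ofReal_mul_I θ
  have hsin := Real.mul_abs_le_abs_sin (x := θ / 2) (by rw [abs_div]; norm_num; linarith)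
  have hlow : 4 / M ≤ ‖z - 1‖ := by
    rw [hz, Complex.norm_exp_I_mul_ofReal_sub_one, norm_mul, Real.norm_eq_abs, Real.norm_eq_abs]
    calc (4 : ℝ) / M = 2 * (2 / Real.pi * ((2 * Real.pi / M) / 2)) := by
          field_simp [Real.pi_ne_zero]; ring
      _ ≤ 2 * (2 / Real.pi * |θ / 2|) := by
          rw [abs_div, abs_two]; gcongr
      _ ≤ |2| * |Real.sin (θ / 2)| := by rw [abs_two]; gcongr
  have hup : ‖∑ j ∈ Finset.range M, z ^ j‖ * ‖z - 1‖ ≤ 2 := by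
    rw [← norm_mul, geom_sum_mul]
    refine (norm_sub_le _ _).trans ?_
    rw [norm_pow, hz1]; norm_num
  have h3 : ‖∑ j ∈ Finset.range M, z ^ j‖ * (4 / M) ≤ 2 :=
    (mul_le_mul_of_nonneg_left hlow (norm_nonneg _)).trans hup
  rw [mul_div_assoc', div_le_iff₀ hM'] at h3
  linarith

/-- A tail of a measure on `[-π / h, π / h]` is controlled by the values of its Fourier transform
at the multiples of `h` near the origin. -/
theorem measureReal_tail_le (μ : Measure ℝ) [IsFiniteMeasure μ] {h : ℝ} (hh : 0 < h) {M : ℕ}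
    (hM : 0 < M) (hsupp : μ {l | Real.pi / h < |l|} = 0) {ε : ℝ}
    (hε : ∀ j < M, ‖∫ l : ℝ, (1 - Complex.exp (Complex.I * l * (j * h : ℝ))) ∂μ‖ ≤ ε) :
    μ.real {l | 2 * Real.pi / (M * h) < |l|} ≤ 2 * ε := by
  have hM' : (0 : ℝ) < M := by exact_mod_cast hM
  let g : ℕ → ℝ → ℂ := fun j l => 1 - Complex.exp (Complex.I * l * (j * h : ℝ))
  have hgre : ∀ j l, (g j l).re = 1 - Real.cos (l * (j * h)) := by
    intro j l
    have : Complex.I * l * (j * h : ℝ) = ((l * (j * h) : ℝ) : ℂ) * Complex.I := by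
      push_cast; ring
    simp only [g]
    rw [this, Complex.sub_re, Complex.one_re, Complex.exp_ofReal_mul_I_re]
  have hgint : ∀ j, Integrable (g j) μ := by
    intro j
    refine Integrable.of_bound (by fun_prop) 2 (ae_of_all _ fun l => ?_)
    refine (norm_sub_le _ _).trans ?_
    have : Complex.I * l * (j * h : ℝ) = ((l * (j * h) : ℝ) : ℂ) * Complex.I := by
      push_cast; ring
    rw [this, Complex.norm_exp_ofReal_mul_I]; norm_num
  -- The integral of `f` is at most `M ε`, while `f ≥ M / 2` on the part of the tail inside `[-π /
  -- h, π / h]`; Markov's inequality concludes.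
  let f : ℝ → ℝ := fun l => ∑ j ∈ Finset.range M, (g j l).re
  have hf0 : 0 ≤ f := fun l => Finset.sum_nonneg fun j _ => by
    rw [hgre]; linarith [Real.cos_le_one (l * (j * h))]
  have hfint : Integrable f μ := integrable_finsetSum _ fun j _ => (hgint j).re
  have hbound : ∫ l, f l ∂μ ≤ M * ε := by
    have hsum : ∫ l, f l ∂μ = ∑ j ∈ Finset.range M, ∫ l, (g j l).re ∂μ :=
      integral_finsetSum _ fun j _ => (hgint j).re
    rw [hsum]
    calc ∑ j ∈ Finset.range M, ∫ l, (g j l).re ∂μ ≤ ∑ j ∈ Finset.range M, ε := by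
          refine Finset.sum_le_sum fun j hj => ?_
          have : ∫ l, (g j l).re ∂μ = (∫ l, g j l ∂μ).re := integral_re (hgint j)
          rw [this]
          exact (Complex.re_le_norm _).trans (hε j (Finset.mem_range.1 hj))
      _ = M * ε := by simp
  have hmarkov := mul_meas_ge_le_integral_of_nonneg (ae_of_all μ hf0) hfint (M / 2 : ℝ)
  have hsub : {l : ℝ | 2 * Real.pi / (M * h) < |l|} ⊆
      {l | Real.pi / h < |l|} ∪ {l | (M / 2 : ℝ) ≤ f l} := by
    intro l hl
    by_cases hl2 : Real.pi / h < |l|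
    · exact Or.inl hl2
    right
    have e : |l * h| = |l| * h := by rw [abs_mul, abs_of_pos hh]
    have key := norm_geom_sum_exp_le (θ := l * h) hM
      (by
        rw [e, div_le_iff₀ hM']
        have := (div_lt_iff₀ (by positivity)).1 (mem_ofPred.1 hl)
        linarith)
      (by
        rw [e]
        exact (le_div_iff₀ hh).1 (not_lt.1 hl2))
    have hre : f l = M - (∑ j ∈ Finset.range M, Complex.exp (Complex.I * (l * h : ℝ)) ^ j).re := by
      simp only [f, g, Complex.sub_re, Complex.one_re, Finset.sum_sub_distrib, Complex.re_sum]
      simp only [Finset.sum_const, Finset.card_range, nsmul_eq_mul, mul_one]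
      congr 1
      refine Finset.sum_congr rfl fun j _ => ?_
      rw [← Complex.exp_nat_mul]
      congr 2
      push_cast
      ring
    have := Complex.re_le_norm (∑ j ∈ Finset.range M, Complex.exp (Complex.I * (l * h : ℝ)) ^ j)
    change (M / 2 : ℝ) ≤ f l
    linarith
  have h4 : μ.real {l : ℝ | 2 * Real.pi / (M * h) < |l|} ≤ μ.real {l | (M / 2 : ℝ) ≤ f l} := by
    refine (measureReal_mono hsub).trans ((measureReal_union_le _ _).trans ?_)
    simp [measureReal_def, hsupp]
  have h5 : (M / 2 : ℝ) * μ.real {l | (M / 2 : ℝ) ≤ f l} ≤ M * ε := hmarkov.trans hbound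
  have h6 : (M : ℝ) * μ.real {l | (M / 2 : ℝ) ≤ f l} ≤ M * (2 * ε) := by linarith
  exact h4.trans (le_of_mul_le_mul_left h6 hM')

/-- A locally positive definite function agrees on a grid with the Fourier transform of a finite
measure. -/
theorem IsLocallyPD.exists_grid_measure {a : ℝ} (ha : 0 < a) {F : ℝ → ℂ} (hF : IsLocallyPD a F)
    {P : ℕ} (hP : 2 ≤ P) :
    ∃ μ : Measure ℝ, IsFiniteMeasure μ ∧ μ {l | Real.pi / (a / P) < |l|} = 0 ∧
      ∀ k : ℕ, k + 1 < P →
        F (k * (a / P)) = ∫ l : ℝ, Complex.exp (Complex.I * l * (k * (a / P) : ℝ)) ∂μ := by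
  have hP' : (0 : ℝ) < P := by exact_mod_cast (by omega : 0 < P)
  set h := a / P with hh
  have hpos : 0 < h := div_pos ha hP'
  -- The points are `h, …, (P - 1) h`, as `0` and `a` are not in `Ω`; their differences reach only
  -- `(P - 2) h`, whence the condition `k + 1 < P`.
  have hx : ∀ i : Fin (P - 2 + 1), ((i : ℕ) + 1) * h ∈ Ioo 0 a := by
    intro i
    refine ⟨by positivity, ?_⟩
    have : ((i : ℕ) + 1 : ℝ) < P := by exact_mod_cast (by omega : (i : ℕ) + 1 < P)
    calc ((i : ℕ) + 1) * h < P * h := by gcongr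
      _ = a := by rw [hh]; field_simp
  have hpsd : (Matrix.of fun i j : Fin (P - 2 + 1) =>
      (fun k : ℤ => F (k * h)) ((i : ℤ) - (j : ℤ))).PosSemidef := by
    have hsub : ∀ i j : Fin (P - 2 + 1), (((i : ℤ) - (j : ℤ) : ℤ) : ℝ) * h =
        ((i : ℕ) + 1) * h - ((j : ℕ) + 1) * h := by
      intro i j; push_cast; ring
    refine Matrix.PosSemidef.of_dotProduct_mulVec_nonneg ?_ fun c => ?_
    · ext i j
      simp only [Matrix.conjTranspose_apply, Matrix.of_apply, hsub]
      exact hF.conj_sub (hx i) (hx j)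
    · refine (hF _ (fun i : Fin (P - 2 + 1) => ((i : ℕ) + 1) * h) c hx).trans_eq ?_
      simp only [dotProduct, Matrix.mulVec, Finset.mul_sum, Matrix.of_apply, hsub, Pi.star_apply]
      refine Finset.sum_congr rfl fun i _ => Finset.sum_congr rfl fun j _ => ?_
      simp only [RCLike.star_def]
      ring
  obtain ⟨ν, hν, hν0, hνk⟩ := exists_measure_of_posSemidef_toeplitz (P - 2) (fun k : ℤ => F (k * h)) hpsd
  have hmeas : Measurable fun θ : ℝ => θ / h := by fun_prop
  refine ⟨ν.map fun θ => θ / h, inferInstance, ?_, fun k hk => ?_⟩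
  · have hms : MeasurableSet {l : ℝ | Real.pi / h < |l|} :=
      measurableSet_lt measurable_const measurable_norm
    rw [Measure.map_apply hmeas hms]
    convert hν0 using 2
    ext θ
    simp only [mem_preimage, mem_ofPred_eq, abs_div, abs_of_pos hpos]
    exact div_lt_div_iff_of_pos_right hpos
  · have := hνk k (by omega)
    rw [integral_map hmeas.aemeasurable (by fun_prop)]
    simp only [Int.cast_natCast] at this
    rw [this]
    refine integral_congr_ae (ae_of_all _ fun θ => ?_)
    have : (h : ℂ) ≠ 0 := by exact_mod_cast hpos.ne'
    dsimp only
    congr 1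
    push_cast
    field_simp

end Krein

/-! ### Weak limits and Krein's extension theorem -/

section Krein

open Filter Topology

/-- Prokhorov compactness. A limit along an ultrafilter avoids passing to subsequences. -/
theorem exists_finiteMeasure_tendsto_of_tail {μ : ℕ → FiniteMeasure ℝ} {C : NNReal}
    (hmass : ∀ n, (μ n).mass = C)
    (htail : ∀ ε > (0 : ℝ), ∃ R : ℝ, ∀ n, (μ n : Measure ℝ).real {l | R < |l|} ≤ ε) :
    ∃ ν : FiniteMeasure ℝ, Tendsto μ (hyperfilter ℕ : Filter ℕ) (𝓝 ν) := by
  choose R hR using fun j : ℕ => htail (1 / ((j : ℝ) + 1)) (by positivity)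
  let u : ℕ → NNReal := fun j => 1 / ((j : NNReal) + 1)
  have hu : Tendsto u atTop (𝓝 0) := tendsto_one_div_add_atTop_nhds_zero_nat
  have hcomp := isCompact_setOfPred_finiteMeasure_mass_eq_compl_isCompact_le (E := ℝ) C hu
    (K := fun j => Metric.closedBall 0 (R j)) (fun j => isCompact_closedBall 0 _)
    (Or.inl inferInstance)
  obtain ⟨ν, -, hν⟩ := hcomp.ultrafilter_le_nhds ((hyperfilter ℕ).map μ) (by
    rw [le_principal_iff, Ultrafilter.mem_coe, Ultrafilter.mem_map]
    refine univ_mem' fun n => ⟨hmass n, fun j => ?_⟩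
    have hc : (Metric.closedBall (0 : ℝ) (R j))ᶜ = {l | R j < |l|} := by
      ext l; simp
    rw [hc, ← NNReal.coe_le_coe]
    simpa [u] using hR j n)
  exact ⟨ν, hν⟩

theorem FiniteMeasure.tendsto_integral_exp {μ : ℕ → FiniteMeasure ℝ} {ν : FiniteMeasure ℝ}
    {f : Filter ℕ} (h : Tendsto μ f (𝓝 ν)) (x : ℝ) :
    Tendsto (fun n => ∫ l : ℝ, Complex.exp (Complex.I * l * x) ∂(μ n : Measure ℝ)) f
      (𝓝 (∫ l : ℝ, Complex.exp (Complex.I * l * x) ∂(ν : Measure ℝ))) := by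
  rw [FiniteMeasure.tendsto_iff_forall_integral_rclike_tendsto ℂ] at h
  refine h (BoundedContinuousFunction.ofNormedAddCommGroup
    (fun l : ℝ => Complex.exp (Complex.I * l * x)) (by fun_prop) 1 fun l => ?_)
  have : Complex.I * l * x = ((l * x : ℝ) : ℂ) * Complex.I := by push_cast; ring
  rw [this, Complex.norm_exp_ofReal_mul_I]

theorem integrable_exp_I_mul (μ : Measure ℝ) [IsFiniteMeasure μ] (x : ℝ) :
    Integrable (fun l : ℝ => Complex.exp (Complex.I * l * x)) μ := by
  refine Integrable.of_bound (by fun_prop) 1 (ae_of_all _ fun l => ?_)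
  have : Complex.I * l * x = ((l * x : ℝ) : ℂ) * Complex.I := by push_cast; ring
  rw [this, Complex.norm_exp_ofReal_mul_I]

theorem continuous_integral_exp (μ : Measure ℝ) [IsFiniteMeasure μ] :
    Continuous fun x : ℝ => ∫ l : ℝ, Complex.exp (Complex.I * l * x) ∂μ := by
  refine continuous_of_dominated (fun x => by fun_prop) (bound := fun _ => 1)
    (fun x => ae_of_all _ fun l => ?_) (integrable_const _) (ae_of_all _ fun l => by fun_prop)
  have : Complex.I * l * x = ((l * x : ℝ) : ℂ) * Complex.I := by push_cast; ring
  rw [this, Complex.norm_exp_ofReal_mul_I]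

theorem conj_integral_exp (μ : Measure ℝ) (x : ℝ) :
    conj (∫ l : ℝ, Complex.exp (Complex.I * l * x) ∂μ) =
      ∫ l : ℝ, Complex.exp (Complex.I * l * (-x : ℝ)) ∂μ := by
  rw [← integral_conj]
  simp [← Complex.exp_conj]

/-- Every point of `(-a, a)` is a difference of the points `(a + x) / 2` and `(a - x) / 2` of `Ω`.
-/
theorem IsLocallyPD.conj_apply {a : ℝ} {F : ℝ → ℂ} (hF : IsLocallyPD a F) {x : ℝ}
    (hx : x ∈ Ioo (-a) a) : conj (F x) = F (-x) := by
  have h1 : (a + x) / 2 ∈ Ioo 0 a := ⟨by linarith [hx.1], by linarith [hx.2]⟩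
  have h2 : (a - x) / 2 ∈ Ioo 0 a := ⟨by linarith [hx.2], by linarith [hx.1]⟩
  convert hF.conj_sub h2 h1 using 2 <;> ring_nf

/-- A continuous function on `(-a, a)` with `F (-x) = conj (F x)` that agrees with the Fourier
transform of `ν` at the dyadic multiples of `a` is the Fourier transform of `ν` on `(-a, a)`. -/
theorem eq_integral_exp_of_dyadic {a : ℝ} (ha : 0 < a) {F : ℝ → ℂ}
    (hcont : ContinuousOn F (Ioo (-a) a)) (hF : IsLocallyPD a F) {ν : Measure ℝ}
    [IsFiniteMeasure ν]
    (h : ∀ n k : ℕ, k < 2 ^ (n + 1) → F (k * (a / 2 ^ (n + 1))) =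
      ∫ l : ℝ, Complex.exp (Complex.I * l * (k * (a / 2 ^ (n + 1)) : ℝ)) ∂ν)
    {x : ℝ} (hx : x ∈ Ioo (-a) a) : F x = ∫ l : ℝ, Complex.exp (Complex.I * l * x) ∂ν := by
  have hpos : ∀ y, 0 ≤ y → y < a → F y = ∫ l : ℝ, Complex.exp (Complex.I * l * y) ∂ν := by
    intro y hy0 hya
    let k : ℕ → ℕ := fun n => ⌊y / a * 2 ^ (n + 1)⌋₊
    let q : ℕ → ℝ := fun n => k n * (a / 2 ^ (n + 1))
    have h2 : Tendsto (fun n : ℕ => (2 : ℝ) ^ (n + 1)) atTop atTop :=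
      (tendsto_pow_atTop_atTop_of_one_lt one_lt_two).comp (tendsto_add_atTop_nat 1)
    have hq : Tendsto q atTop (𝓝 y) := by
      have := ((tendsto_nat_floor_mul_div_atTop (div_nonneg hy0 ha.le)).comp h2).mul_const a
      rw [div_mul_cancel₀ _ ha.ne'] at this
      refine this.congr fun n => ?_
      simp only [Function.comp, q, k]
      ring
    have hk : ∀ n, k n < 2 ^ (n + 1) := by
      intro n
      rw [Nat.floor_lt (by positivity)]
      have : y / a < 1 := (div_lt_one ha).2 hya
      push_cast
      exact mul_lt_of_lt_one_left (by positivity) this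
    have hFy : ContinuousAt F y := hcont.continuousAt (Ioo_mem_nhds (by linarith) hya)
    refine tendsto_nhds_unique (hFy.tendsto.comp hq) ?_
    refine (((continuous_integral_exp ν).tendsto y).comp hq).congr fun n => ?_
    exact (h n (k n) (hk n)).symm
  rcases le_total 0 x with h0 | h0
  · exact hpos x h0 hx.2
  · have hx' : -x ∈ Ioo (-a) a := ⟨by linarith [hx.2], by linarith [hx.1]⟩
    have := congrArg conj (hpos (-x) (by linarith) hx'.2)
    rwa [hF.conj_apply hx', conj_integral_exp, neg_neg] at this

/-- **Krein's extension theorem**: a continuous locally positive definite function is the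
restriction of the Fourier transform of a finite measure. -/
theorem IsLocallyPD.extMeasures_nonempty {a : ℝ} (ha : 0 < a) {F : ℝ → ℂ}
    (hcont : ContinuousOn F (Ioo (-a) a)) (hF : IsLocallyPD a F) : (ExtMeasures a F).Nonempty := by
  have h2pos : ∀ n : ℕ, (0 : ℝ) < 2 ^ n := fun n => by positivity
  have htwo : ∀ n : ℕ, 2 ≤ 2 ^ (n + 1) := fun n => by
    rw [pow_succ]; have := Nat.one_le_two_pow (n := n); omega
  choose μ hfin hsupp hμ using fun n : ℕ => hF.exists_grid_measure ha (htwo n)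
  simp only [Nat.cast_pow, Nat.cast_ofNat] at hsupp hμ
  have hone : ∀ n, F 0 = ((μ n).real univ : ℂ) := by
    intro n
    have := hμ n 0 (htwo n)
    simpa using this
  let m : ℕ → FiniteMeasure ℝ := fun n => ⟨μ n, hfin n⟩
  have hmass : ∀ n, (m n).mass = (m 0).mass := by
    intro n
    have := (hone n).symm.trans (hone 0)
    have h' : (μ n).real univ = (μ 0).real univ := by exact_mod_cast this
    exact NNReal.coe_injective h'
  have htail : ∀ ε > (0 : ℝ), ∃ R : ℝ, ∀ n, (m n : Measure ℝ).real {l | R < |l|} ≤ ε := by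
    intro ε hε
    have hF0 : ContinuousAt F 0 := hcont.continuousAt (Ioo_mem_nhds (by linarith) ha)
    obtain ⟨δ, hδ, hFδ⟩ := Metric.continuousAt_iff.1 hF0 (ε / 2) (half_pos hε)
    obtain ⟨p, hp⟩ : ∃ p : ℕ, a / 2 ^ p < δ := by
      obtain ⟨p, hp⟩ := pow_unbounded_of_one_lt (a / δ) one_lt_two
      exact ⟨p, (div_lt_comm₀ hδ (h2pos p)).1 hp⟩
    -- For `n < p` the measure already lives in `[-R, R]`. For `n ≥ p`, taking `M = 2 ^ (n - p)`
    -- makes `M h = a / 2 ^ (p + 1) < δ`, independent of `n`.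
    refine ⟨2 * Real.pi / (a / 2 ^ (p + 1)), fun n => ?_⟩
    have hpδ : a / 2 ^ (p + 1) < δ := lt_of_le_of_lt (by gcongr <;> norm_num) hp
    rcases lt_or_ge n p with hnp | hnp
    · have : (m n : Measure ℝ) {l | 2 * Real.pi / (a / 2 ^ (p + 1)) < |l|} = 0 := by
        refine measure_mono_null (fun l hl => ?_) (hsupp n)
        refine lt_of_le_of_lt ?_ (mem_ofPred.1 hl)
        have : Real.pi ≤ 2 * Real.pi := by linarith [Real.pi_pos]
        gcongr
        norm_num
      rw [measureReal_def, this]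
      exact hε.le
    · have hM : 0 < 2 ^ (n - p) := by positivity
      have e1 : ((2 ^ (n - p) : ℕ) : ℝ) * (a / 2 ^ (n + 1)) = a / 2 ^ (p + 1) := by
        have : (2 : ℝ) ^ (n + 1) = 2 ^ (n - p) * 2 ^ (p + 1) := by
          rw [← pow_add]; congr 1; omega
        rw [this]; push_cast; field_simp
      have := measureReal_tail_le (μ n) (h := a / 2 ^ (n + 1)) (div_pos ha (h2pos _)) hM
        (hsupp n) (ε := ε / 2) (fun j hj => ?_)
      · rw [e1] at this
        exact this.trans (by linarith)
      · have hj2 : j + 1 < 2 ^ (n + 1) := by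
          have h1 : 2 ^ (n - p) ≤ 2 ^ n := Nat.pow_le_pow_right two_pos (by omega)
          have h2 := Nat.one_le_two_pow (n := n)
          rw [pow_succ]; omega
        have hjx : (j : ℝ) * (a / 2 ^ (n + 1)) < δ := by
          refine lt_of_le_of_lt ?_ hpδ
          rw [← e1]
          gcongr
        have e2 : ∫ l : ℝ, (1 - Complex.exp (Complex.I * l * (j * (a / 2 ^ (n + 1)) : ℝ))) ∂μ n
            = F 0 - F (j * (a / 2 ^ (n + 1))) := by
          rw [integral_sub (integrable_const _) (integrable_exp_I_mul _ _), ← hμ n j hj2, hone n]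
          simp
        rw [e2, ← dist_eq_norm, dist_comm]
        refine (hFδ ?_).le
        rw [Real.dist_eq, sub_zero, abs_of_nonneg (by positivity)]
        exact hjx
  obtain ⟨ν, hν⟩ := exists_finiteMeasure_tendsto_of_tail hmass htail
  refine ⟨ν, inferInstance, fun x hx => eq_integral_exp_of_dyadic ha hcont hF (fun n k hk => ?_) hx⟩
  refine tendsto_nhds_unique (tendsto_const_nhds.congr' ?_)
    (FiniteMeasure.tendsto_integral_exp hν (k * (a / 2 ^ (n + 1))))
  -- Grid points stay grid points under refinement. Strict refinement matters: the last point of a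
  -- grid is not matched by its own measure.
  have hev : ∀ᶠ N : ℕ in (hyperfilter ℕ : Filter ℕ), n < N :=
    Nat.hyperfilter_le_atTop (eventually_gt_atTop n)
  filter_upwards [hev] with N hN
  have e3 : ((k * 2 ^ (N - n) : ℕ) : ℝ) * (a / 2 ^ (N + 1)) = k * (a / 2 ^ (n + 1)) := by
    have : (2 : ℝ) ^ (N + 1) = 2 ^ (N - n) * 2 ^ (n + 1) := by
      rw [← pow_add]; congr 1; omega
    rw [this]; push_cast; field_simp
  have hlt : k * 2 ^ (N - n) + 1 < 2 ^ (N + 1) := by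
    have h1 : 2 ^ (N + 1) = 2 ^ (n + 1) * 2 ^ (N - n) := by
      rw [← pow_add]; congr 1; omega
    have h2 : (k + 1) * 2 ^ (N - n) ≤ 2 ^ (n + 1) * 2 ^ (N - n) := Nat.mul_le_mul_right _ hk
    have h3 : 1 < 2 ^ (N - n) := Nat.one_lt_two_pow (by omega)
    rw [h1]; rw [add_mul] at h2; omega
  have := hμ N _ hlt
  rwa [e3] at this

end Krein

/-! ### Membership in `ℋ_F` as domination by the kernel -/

section RKHSDomination

/-- A function `φ` on the index set of a family `v` in a Hilbert space that is dominated by the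
Gram matrix of `v` is represented by a vector. -/
theorem exists_inner_eq_of_dominated {H X : Type*} [NormedAddCommGroup H] [InnerProductSpace ℂ H]
    [CompleteSpace H] (v : X → H) (φ : X → ℂ) (C : ℝ)
    (h : ∀ c : X →₀ ℂ, ‖c.sum fun x z => z * φ x‖ ≤ C * ‖c.sum fun x z => z • v x‖) :
    ∃ f : H, ∀ x, inner ℂ f (v x) = φ x := by
  classical
  let A := Finsupp.linearCombination ℂ v
  let B := Finsupp.linearCombination ℂ φ
  have hAB : ∀ c, ‖B c‖ ≤ C * ‖A c‖ := fun c => by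
    simpa [A, B, Finsupp.linearCombination_apply] using h c
  have hker : LinearMap.ker A ≤ LinearMap.ker B := fun c hc => by
    rw [LinearMap.mem_ker] at hc ⊢
    simpa [hc] using hAB c
  let T : LinearMap.range A →ₗ[ℂ] ℂ :=
    ((LinearMap.ker A).liftQ B hker).comp A.quotKerEquivRange.symm.toLinearMap
  have hT : ∀ c, T ⟨A c, LinearMap.mem_range_self A c⟩ = B c := by
    intro c
    have : A.quotKerEquivRange.symm ⟨A c, LinearMap.mem_range_self A c⟩ =
        (LinearMap.ker A).mkQ c := by
      rw [LinearEquiv.symm_apply_eq]; rfl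
    simp [T, this]
  let L : StrongDual ℂ (LinearMap.range A) := T.mkContinuous C (by
    rintro ⟨_, c, rfl⟩
    rw [hT]
    exact hAB c)
  -- Hahn–Banach extends the bounded functional from the span to `H`, where Riesz represents it.
  obtain ⟨g, hg, -⟩ := exists_extension_norm_eq (LinearMap.range A) L
  refine ⟨(InnerProductSpace.toDual ℂ H).symm g, fun x => ?_⟩
  rw [InnerProductSpace.toDual_symm_apply]
  have hA : A (Finsupp.single x 1) = v x := by simp [A]
  have hB : B (Finsupp.single x 1) = φ x := by simp [B]
  rw [← hA, ← hB, ← hT]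
  exact hg ⟨A (Finsupp.single x 1), _⟩

theorem inner_sum_smul_self {H X : Type*} [NormedAddCommGroup H] [InnerProductSpace ℂ H]
    {k : X → H} {K : X → X → ℂ} (hk : ∀ x y, inner ℂ (k x) (k y) = K x y) (t : Finset X)
    (s : X → ℂ) : inner ℂ (∑ x ∈ t, s x • k x) (∑ x ∈ t, s x • k x) =
      ∑ x ∈ t, ∑ y ∈ t, conj (s x) * s y * K x y := by
  rw [sum_inner]
  refine Finset.sum_congr rfl fun x _ => ?_
  rw [inner_sum]
  refine Finset.sum_congr rfl fun y _ => ?_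
  rw [inner_smul_left, inner_smul_right, hk, mul_assoc]

/-- The functions of the space `ℋ_F` are the functions `x ↦ ⟪k x, f⟫` for a family of vectors `k`
with `⟪k x, k y⟫ = F (x - y)`. -/
theorem exists_hilbert_mem_localRKHS_iff {a : ℝ} {F : ℝ → ℂ} (hF : IsLocallyPD a F) :
    ∃ (H : Type) (_ : NormedAddCommGroup H) (_ : InnerProductSpace ℂ H) (_ : CompleteSpace H)
      (k : Ioo (0 : ℝ) a → H), (∀ x y, inner ℂ (k x) (k y) = F ((x : ℝ) - (y : ℝ))) ∧
      ∀ φ : Ioo (0 : ℝ) a → ℂ, φ ∈ localRKHS hF ↔ ∃ f : H, ∀ x, inner ℂ (k x) f = φ x := by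
  have : Fact (localKernel a F).PosSemidef := ⟨hF.posSemidef⟩
  refine ⟨RKHS.OfKernel (localKernel a F), inferInstance, inferInstance, inferInstance,
    fun x => RKHS.kerFun (RKHS.OfKernel (localKernel a F)) x (1 : ℂ), fun x y => ?_, fun φ => ?_⟩
  · rw [RKHS.kerFun_inner, RKHS.kerFun_apply, RKHS.OfKernel.kernel_ofKernel]
    simp [localKernel]
  · simp only [RKHS.kerFun_inner]
    constructor
    · rintro ⟨f, rfl⟩
      exact ⟨f, fun x => by simp⟩
    · rintro ⟨f, hf⟩
      exact ⟨f, funext fun x => by simpa using hf x⟩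

/-- A function `φ` with `0 < c` and `c * φ x * conj (φ y) ≤ F (x - y)` in the sense of positive
definite kernels belongs to `ℋ_F`. -/
theorem mem_localRKHS_of_dominated {a : ℝ} {F : ℝ → ℂ} (hF : IsLocallyPD a F) {c : ℝ} (hc : 0 < c)
    (φ : Ioo (0 : ℝ) a → ℂ)
    (h : ∀ s : Ioo (0 : ℝ) a →₀ ℂ, c * ‖s.sum fun x z => z * conj (φ x)‖ ^ 2 ≤
      (s.sum fun x z => s.sum fun y w => conj z * w * F ((x : ℝ) - (y : ℝ))).re) :
    φ ∈ localRKHS hF := by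
  obtain ⟨H, _, _, _, k, hk, hmem⟩ := exists_hilbert_mem_localRKHS_iff hF
  rw [hmem]
  -- Conjugated, because the criterion yields `⟪f, k x⟫` whereas membership needs `⟪k x, f⟫`.
  obtain ⟨f, hf⟩ := exists_inner_eq_of_dominated k (fun x => conj (φ x)) (√c)⁻¹ fun s => by
    have h1 : (s.sum fun x z => s.sum fun y w => conj z * w * F ((x : ℝ) - (y : ℝ))) =
        inner ℂ (s.sum fun x z => z • k x) (s.sum fun x z => z • k x) := by
      simp only [Finsupp.sum]
      exact (inner_sum_smul_self hk _ _).symm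
    have h2 := h s
    rw [h1, inner_self_eq_norm_sq_to_K] at h2
    norm_cast at h2
    rw [inv_mul_eq_div, le_div_iff₀ (Real.sqrt_pos.2 hc)]
    refine (pow_le_pow_iff_left₀ (by positivity) (norm_nonneg _) two_ne_zero).1 ?_
    rw [mul_pow, Real.sq_sqrt hc.le, mul_comm]
    exact h2
  exact ⟨f, fun x => by rw [← inner_conj_symm, hf, Complex.conj_conj]⟩

/-- A function of `ℋ_F` is dominated by a multiple of the kernel of `ℋ_F`. -/
theorem exists_dominated_of_mem_localRKHS {a : ℝ} {F : ℝ → ℂ} (hF : IsLocallyPD a F)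
    {φ : Ioo (0 : ℝ) a → ℂ} (hφ : φ ∈ localRKHS hF) :
    ∃ c : ℝ, 0 < c ∧ ∀ (n : ℕ) (x : Fin n → Ioo (0 : ℝ) a) (s : Fin n → ℂ),
      ((c * ‖∑ i, conj (s i) * φ (x i)‖ ^ 2 : ℝ) : ℂ) ≤
        ∑ i, ∑ j, conj (s i) * s j * F ((x i : ℝ) - (x j : ℝ)) := by
  obtain ⟨H, _, _, _, k, hk, hmem⟩ := exists_hilbert_mem_localRKHS_iff hF
  obtain ⟨f, hf⟩ := (hmem φ).1 hφ
  -- Cauchy–Schwarz gives the bound with `‖f‖ ^ 2`; the `+ 1` covers `f = 0`.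
  refine ⟨(‖f‖ ^ 2 + 1)⁻¹, by positivity, fun n x s => ?_⟩
  have h1 : ∑ i, ∑ j, conj (s i) * s j * F ((x i : ℝ) - (x j : ℝ)) =
      inner ℂ (∑ i, s i • k (x i)) (∑ i, s i • k (x i)) := by
    exact (inner_sum_smul_self (fun i j => hk (x i) (x j)) _ _).symm
  have h2 : ∑ i, conj (s i) * φ (x i) = inner ℂ (∑ i, s i • k (x i)) f := by
    simp only [sum_inner, inner_smul_left, hf]
  have h0 : inner ℂ (∑ i, s i • k (x i)) (∑ i, s i • k (x i)) =
      ((‖∑ i, s i • k (x i)‖ ^ 2 : ℝ) : ℂ) := by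
    rw [inner_self_eq_norm_sq_to_K]; push_cast; rfl
  rw [h1, h2, h0, Complex.real_le_real, inv_mul_le_iff₀ (by positivity)]
  have h3 := norm_inner_le_norm (𝕜 := ℂ) (∑ i, s i • k (x i)) f
  calc _ ≤ (‖∑ i, s i • k (x i)‖ * ‖f‖) ^ 2 := by gcongr
    _ ≤ _ := by rw [mul_pow]; nlinarith [sq_nonneg ‖∑ i, s i • k (x i)‖]

end RKHSDomination

/-! ### The two implications -/

theorem mem_localRKHS_of_atom {a : ℝ} {F : ℝ → ℂ} (hF : IsLocallyPD a F) {μ : Measure ℝ}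
    (hμ : μ ∈ ExtMeasures a F) {l₁ : ℝ} (hl : 0 < μ {l₁}) :
    (fun x : Ioo (0 : ℝ) a => Complex.exp (Complex.I * (l₁ : ℂ) * ((x : ℝ) : ℂ))) ∈
      localRKHS hF := by
  obtain ⟨hfin, hFμ⟩ := hμ
  have hc : 0 < μ.real {l₁} := ENNReal.toReal_pos hl.ne' (measure_ne_top μ _)
  refine mem_localRKHS_of_dominated hF hc _ fun s => ?_
  let g : ℝ → ℂ := fun l => s.sum fun x z => z * conj (Complex.exp (Complex.I * l * (x : ℝ)))
  have hg : ∀ l : ℝ, ((‖g l‖ ^ 2 : ℝ) : ℂ) = ∑ x ∈ s.support, ∑ y ∈ s.support,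
      conj (s x) * s y * Complex.exp (Complex.I * l * ((x : ℝ) - (y : ℝ) : ℝ)) := by
    intro l
    rw [Complex.ofReal_pow, ← Complex.conj_mul']
    simp only [g, Finsupp.sum, map_sum, Finset.sum_mul_sum]
    refine Finset.sum_congr rfl fun x _ => Finset.sum_congr rfl fun y _ => ?_
    have : Complex.exp (Complex.I * l * ((x : ℝ) - (y : ℝ) : ℝ)) =
        Complex.exp (Complex.I * l * (x : ℝ)) * conj (Complex.exp (Complex.I * l * (y : ℝ))) := by
      rw [← Complex.exp_conj, ← Complex.exp_add]
      congr 1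
      simp
      ring
    rw [this]
    simp only [map_mul, Complex.conj_conj]
    ring
  have hint : ∀ x ∈ s.support, ∀ y ∈ s.support, Integrable (fun l : ℝ =>
      conj (s x) * s y * Complex.exp (Complex.I * l * ((x : ℝ) - (y : ℝ) : ℝ))) μ :=
    fun x _ y _ => (integrable_exp_I_mul μ _).const_mul _
  have hgint : Integrable (fun l => ((‖g l‖ ^ 2 : ℝ) : ℂ)) μ := by
    simp_rw [hg]
    exact integrable_finsetSum _ fun x hx => integrable_finsetSum _ fun y hy => hint x hx y hy
  have hgint' : Integrable (fun l => ‖g l‖ ^ 2) μ := hgint.re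
  have hsum : (s.sum fun x z => s.sum fun y w => conj z * w * F ((x : ℝ) - (y : ℝ))) =
      ((∫ l, ‖g l‖ ^ 2 ∂μ : ℝ) : ℂ) := by
    rw [← integral_complex_ofReal]
    simp_rw [hg]
    rw [integral_finsetSum _ fun x hx => integrable_finsetSum _ fun y hy => hint x hx y hy]
    refine Finset.sum_congr rfl fun x hx => ?_
    rw [integral_finsetSum _ fun y hy => hint x hx y hy]
    refine Finset.sum_congr rfl fun y _ => ?_
    have hxy : (x : ℝ) - y ∈ Ioo (-a) a :=
      ⟨by linarith [x.2.1, y.2.2], by linarith [x.2.2, y.2.1]⟩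
    dsimp only
    rw [integral_const_mul, hFμ _ hxy]
  rw [hsum, Complex.ofReal_re]
  -- Only the mass at the atom is kept from the integral of a nonnegative function.
  calc μ.real {l₁} * ‖g l₁‖ ^ 2 = ∫ l in {l₁}, ‖g l‖ ^ 2 ∂μ := by
        rw [integral_singleton, smul_eq_mul]
    _ ≤ ∫ l, ‖g l‖ ^ 2 ∂μ :=
        setIntegral_le_integral hgint' (Filter.Eventually.of_forall fun l => by positivity)

theorem exists_atom_of_mem_localRKHS {a : ℝ} (ha : 0 < a) {F : ℝ → ℂ}
    (hcont : ContinuousOn F (Ioo (-a) a)) (hF : IsLocallyPD a F) {l₁ : ℝ}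
    (h : (fun x : Ioo (0 : ℝ) a => Complex.exp (Complex.I * (l₁ : ℂ) * ((x : ℝ) : ℂ))) ∈
      localRKHS hF) :
    ∃ μ ∈ ExtMeasures a F, 0 < μ {l₁} := by
  obtain ⟨c, hc, hdom⟩ := exists_dominated_of_mem_localRKHS hF h
  -- Domination says exactly that `G` is still positive definite; the mass `c` removed here returns
  -- as the atom.
  let G : ℝ → ℂ := fun x => F x - c * Complex.exp (Complex.I * l₁ * x)
  have hG : IsLocallyPD a G := by
    intro n x s hx
    have hle := hdom n (fun i => ⟨x i, hx i⟩) s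
    rw [← sub_nonneg] at hle
    refine hle.trans_eq ?_
    have hsq : ((c * ‖∑ i, conj (s i) * Complex.exp (Complex.I * l₁ * (x i : ℝ))‖ ^ 2 : ℝ) : ℂ) =
        ∑ i, ∑ j, conj (s i) * s j * (c * Complex.exp (Complex.I * l₁ * (x i - x j : ℝ))) := by
      rw [Complex.ofReal_mul, Complex.ofReal_pow, ← Complex.mul_conj']
      rw [map_sum, Finset.sum_mul_sum, Finset.mul_sum]
      simp only [Finset.mul_sum]
      refine Finset.sum_congr rfl fun i _ => Finset.sum_congr rfl fun j _ => ?_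
      have : Complex.exp (Complex.I * l₁ * (x i - x j : ℝ)) =
          Complex.exp (Complex.I * l₁ * (x i : ℝ)) *
            conj (Complex.exp (Complex.I * l₁ * (x j : ℝ))) := by
        rw [← Complex.exp_conj, ← Complex.exp_add]
        congr 1
        simp
        ring
      rw [this]
      simp only [map_mul, Complex.conj_conj]
      ring
    dsimp only at hsq ⊢
    rw [hsq]
    simp only [G, mul_sub, Finset.sum_sub_distrib]
  have hGcont : ContinuousOn G (Ioo (-a) a) := hcont.sub (by fun_prop)
  obtain ⟨ν, hν, hνG⟩ := hG.extMeasures_nonempty ha hGcont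
  refine ⟨ν + c.toNNReal • Measure.dirac l₁, ⟨inferInstance, fun x hx => ?_⟩, ?_⟩
  · rw [integral_add_measure (integrable_exp_I_mul _ _) (integrable_exp_I_mul _ _), ← hνG x hx,
      integral_smul_nnreal_measure, integral_dirac, NNReal.smul_def, Real.coe_toNNReal _ hc.le,
      Complex.real_smul, sub_add_cancel]
  · simp [hc]

theorem mainTheorem8 (a : ℝ) (ha : 0 < a) (l₁ : ℝ) (F : ℝ → ℂ)
    (hcont : ContinuousOn F (Ioo (-a) a)) (hF : IsLocallyPD a F) :
    (∃ μ₁ ∈ ExtMeasures a F, 0 < μ₁ {l₁}) ↔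
      (fun x : Ioo (0 : ℝ) a => Complex.exp (Complex.I * (l₁ : ℂ) * ((x : ℝ) : ℂ))) ∈
        localRKHS hF :=
  ⟨fun ⟨_, hμ, hl⟩ => mem_localRKHS_of_atom hF hμ hl,
    exists_atom_of_mem_localRKHS ha hcont hF⟩
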